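/- For $k=1,2,3$ let $$g_k(z)=a_k\Big(1+(-1)^k\frac{4k}{B_k}\sum_{n\ge 1}\sigma_{2k-1}(n)e^{2\pi i n z}\Big),\qquad z\in\mathbb H=\{z\in\mathbb C:\operatorname{Im} z>0\},$$ where $B_1=\frac16,\ B_2=\frac1{30},\ B_3=\frac1{42}$, $\sigma_j(n)=\sum_{d\mid n}d^j$, and $a_1=2\zeta(2)\frac{-1}{2\pi i}$, $a_2=2\zeta(4)\frac{60}{(2\pi i)^2}$, $a_3=2\zeta(6)\frac{-140}{(2\pi i)^3}$. For integers $n\ge 0$ and $m\in\mathbb Z$ an $M^n_m$-function with associated functions $f_1,\dots,f_n$ is defined by induction on $n$: it is a holomorphic function $f$ on $\mathbb H$ that has a finite limit as $\operatorname{Im} z\to+\infty$ (uniformly in $\operatorname{Re} z$), such that for all $z\in\mathbb H$ and all $A=\begin{pmatrix}a&b\\c&d\end{pmatrix}\in \mathrm{SL}(2,\mathbb Z)$ $$(cz+d)^{-m}f(Az)-f(z)=\sum_{i=1}^n\binom ni c^i(cz+d)^{-i}f_i(z),$$ and such that each $f_i$ $(1\le i\le n)$ is an $M^{n-i}_{m-2i}$-function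 with associated functions $f_{i+1},\dots,f_n$. Let $M^n_m$ be the $\mathbb C$-vector space of these functions (so $M^0_m$ is the space of classical modular forms of weight $m$ for $\mathrm{SL}(2,\mathbb Z)$), and let $M=\sum_{n,m}M^n_m$, the sum being taken inside the $\mathbb C$-algebra of functions on $\mathbb H$. **Theorem.** We have $g_1\in M^1_2$, $g_2\in M^0_4$, $g_3\in M^0_6$, and $g_1,g_2,g_3$ are algebraically independent over $\mathbb C$. The products satisfy $M^n_mM^{n'}_{m'}\subset M^{n+n'}_{m+m'}$, the sum $M=\bigoplus_{m\in\mathbb Z}\big(\bigcup_{n}M^n_m\big)$ over the weights is direct, and $M=\mathbb C[g_1,g_2,g_3]$; thus $M$ is freely generated by $g_1,g_2,g_3$ as a $\mathbb C$-algebra. More precisely, $M^n_m$ is spanned by the monomials $g_1^ag_2^bg_3^c$ with $a,b,c\ge 0$, $2a+4b+6c=m$ and $a\le n$, for all $n\geq 0$ and $m\in\mathbb Z$. In particular every $M^n_m$ is a finite-dimensional $\mathbb C$-vector space. -/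

import Mathlib

open scoped UpperHalfPlane Manifold MatrixGroups ModularForm Topology

namespace DiffModForm

noncomputable section

/-- `HasAssociated n m F`: the function `F 0` on the upper half plane is an `M^n_m`-function for the
full modular group whose associated functions are `F 1, …, F n`.
It is defined by induction on `n`: `F 0` is holomorphic, it satisfies
`(F 0)|_m A - F 0 = ∑_{i=1}^n (n choose i) c_A^i (c_A z + d_A)^{-i} F i` for all `A ∈ SL(2,ℤ)`, each
`F i` (`1 ≤ i ≤ n`) is an `M^{n-i}_{m-2i}`-function whose `j`-th associated function is `F (i + j)`,
and `F 0` has a finite limit as `Im z → +∞`. Values `F i` with `i > n` play no role.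
For `n = 0` the sum is empty and this says that `F 0` is a classical modular form of weight `m`. -/
inductive HasAssociated : ℕ → ℤ → (ℕ → ℍ → ℂ) → Prop
  | intro (n : ℕ) (m : ℤ) (F : ℕ → ℍ → ℂ)
      (holo : MDifferentiable 𝓘(ℂ) 𝓘(ℂ) (F 0))
      (transf : ∀ (A : SL(2, ℤ)) (z : ℍ),
        (F 0 ∣[m] A) z - F 0 z =
          ∑ i ∈ Finset.Icc 1 n, (n.choose i : ℂ) * (A 1 0 : ℂ) ^ i *
            (((A 1 0 : ℂ) * (z : ℂ) + (A 1 1 : ℂ)) ^ i)⁻¹ * F i z)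
      (assoc : ∀ i : ℕ, 1 ≤ i → i ≤ n →
        HasAssociated (n - i) (m - 2 * (i : ℤ)) (fun j => F (i + j)))
      (growth : ∃ a : ℂ, Filter.Tendsto (F 0) UpperHalfPlane.atImInfty (𝓝 a)) :
      HasAssociated n m F

theorem hasAssociated_zero (n : ℕ) (m : ℤ) : HasAssociated n m (fun _ => 0) := by
  induction n using Nat.strong_induction_on generalizing m with
  | _ n ih =>
    refine .intro n m _ mdifferentiable_const ?_ ?_ ⟨0, tendsto_const_nhds⟩
    · intro A z
      simp
    · intro i h1 h2
      exact ih (n - i) (by omega) _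

theorem HasAssociated.add {n : ℕ} {m : ℤ} {F G : ℕ → ℍ → ℂ} (hF : HasAssociated n m F)
    (hG : HasAssociated n m G) : HasAssociated n m (fun i => F i + G i) := by
  induction hF generalizing G with
  | intro n m F h1 h2 h3 h4 ih =>
    cases hG with
    | intro _ _ _ k1 k2 k3 k4 =>
      refine .intro n m _ (h1.add k1) ?_ ?_ ?_
      · intro A z
        simp only [SlashAction.add_slash, Pi.add_apply, mul_add, Finset.sum_add_distrib]
        linear_combination h2 A z + k2 A z
      · intro i hi hn
        exact ih i hi hn (k3 i hi hn)
      · obtain ⟨a, ha⟩ := h4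
        obtain ⟨b, hb⟩ := k4
        exact ⟨a + b, ha.add hb⟩

theorem HasAssociated.smul {n : ℕ} {m : ℤ} {F : ℕ → ℍ → ℂ} (c : ℂ) (hF : HasAssociated n m F) :
    HasAssociated n m (fun i => c • F i) := by
  induction hF with
  | intro n m F h1 h2 h3 h4 ih =>
    refine .intro n m _ (h1.const_smul c) ?_ ?_ ?_
    · intro A z
      have h := congrArg (c * ·) (h2 A z)
      simp only [Finset.mul_sum] at h
      rw [ModularForm.SL_smul_slash]
      simp only [Pi.smul_apply, smul_eq_mul]
      rw [← mul_sub, h]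
      exact Finset.sum_congr rfl fun i _ => by ring
    · intro i hi hn
      exact ih i hi hn
    · obtain ⟨a, ha⟩ := h4
      exact ⟨c • a, ha.const_smul c⟩

/-- The complex vector space `M^n_m` of `M^n_m`-functions (differential modular forms of weight `m`
and order at most `n`) inside the algebra of all functions `ℍ → ℂ`. -/
def M (n : ℕ) (m : ℤ) : Submodule ℂ (ℍ → ℂ) where
  carrier := {f | ∃ F : ℕ → ℍ → ℂ, F 0 = f ∧ HasAssociated n m F}
  zero_mem' := ⟨fun _ => 0, rfl, hasAssociated_zero n m⟩
  add_mem' := by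
    rintro _ _ ⟨F, rfl, hF⟩ ⟨G, rfl, hG⟩
    exact ⟨_, rfl, hF.add hG⟩
  smul_mem' := by
    rintro c _ ⟨F, rfl, hF⟩
    exact ⟨_, rfl, hF.smul c⟩

/-- `a (1 + (-1)^k (4k / B_k) ∑_{n ≥ 1} σ_{2k-1}(n) e^{2πinz})`, where
`B_1 = 1/6, B_2 = 1/30, B_3 = 1/42, …` are the absolute values of the Bernoulli numbers of even
index. -/
def eis (k : ℕ) (a : ℂ) (z : ℍ) : ℂ :=
  a * (1 + (-1) ^ k * (4 * (k : ℂ) / ((|bernoulli (2 * k)| : ℚ) : ℂ)) *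
    ∑' n : ℕ+, (ArithmeticFunction.sigma (2 * k - 1) (n : ℕ) : ℂ) *
      Complex.exp (2 * Real.pi * Complex.I * (z : ℂ) * ((n : ℕ) : ℂ)))

/-- The Eisenstein series of weight `2`, with its normalising constant. -/
def g₁ : ℍ → ℂ := eis 1 (2 * riemannZeta 2 * (-1 / (2 * Real.pi * Complex.I)))

/-- The Eisenstein series of weight `4`, with its normalising constant. -/
def g₂ : ℍ → ℂ := eis 2 (2 * riemannZeta 4 * (60 / (2 * Real.pi * Complex.I) ^ 2))

/-- The Eisenstein series of weight `6`, with its normalising constant. -/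
def g₃ : ℍ → ℂ := eis 3 (2 * riemannZeta 6 * (-140 / (2 * Real.pi * Complex.I) ^ 3))

end

end DiffModForm

/-!
Attach to an `M^n_m`-function with associated functions `F 1, …, F n` the polynomial
`P = ∑ j, (n choose j) F j X ^ j`. The defining conditions say that, when the coefficient of `X ^ j`
is slashed in weight `m - 2j`, the matrix `A` acts on `P` by the translation `X ↦ X + c / (cz + d)`
(`mem_M_iff`). Translations are ring homomorphisms, so products of such functions multiply weights
and add orders (`mul_mem_M`). The Eisenstein series of weight two corresponds to the linear
polynomial `E2 + κ X` with `κ ≠ 0` (`isAssociatedPolynomial_E2`).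

The leading coefficient of `P` is translation invariant, hence a classical modular form. Subtracting
its product with `(κ⁻¹ (E2 + κ X)) ^ n` lowers the degree, so that every `M^n_m`-function is a
polynomial in `E2` with modular forms as coefficients (`mem_span_eisenstein`). Modular forms are in
turn polynomials in `E₄` and `E₆` (`modularForm_mem_span`), by division by the discriminant
`Δ = (E₄³ - E₆²) / 1728`. As `g₁, g₂, g₃` are non-zero multiples of `E2, E₄, E₆`, this gives the
spanning statement `M_eq_span`, which contains finite dimensionality and the generation of the
algebra.

Algebraic independence (`algebraicIndependent_g`) comes from applying the transformation laws to a
relation: for fixed `z` it becomes a polynomial identity in `c` and `cz + d`, where these may be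
replaced by arbitrary complex numbers. This frees the first variable and the scaling of the other
two, and `E₄³ / E₆²` takes infinitely many values because it tends to `1` at `i∞` without ever being
equal to `1`. Independence of the weights is then the linear independence of monomials.
-/

namespace DiffModForm

open Polynomial Filter EisensteinSeries

/-! ### Associated functions as polynomials that transform by translation -/

/-- The coefficients of `p(X + r)`, for a polynomial `p` of degree at most `n`. -/
theorem taylor_coeff_eq_sum {R : Type*} [CommSemiring R] (r : R) {p : R[X]} {n : ℕ}
    (hp : p.natDegree ≤ n) (j : ℕ) :
    (taylor r p).coeff j =
      ∑ i ∈ Finset.range (n - j + 1), ((i + j).choose j : R) * p.coeff (i + j) * r ^ i := by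
  rw [taylor_coeff, eval_eq_sum_range' (n := n - j + 1)]
  · simp [hasseDeriv_coeff]
  · have := natDegree_hasseDeriv_le p j
    omega

/-- The inductive definition unfolded: every `F j` with `j ≤ n` is holomorphic, has a limit at `i∞`
and satisfies the transformation law of order `n - j` and weight `m - 2j`. Here the summand `i = 0`
stands for the function `F j` itself. -/
theorem hasAssociated_iff {n : ℕ} {m : ℤ} {F : ℕ → ℍ → ℂ} :
    HasAssociated n m F ↔ ∀ j ≤ n, MDifferentiable 𝓘(ℂ) 𝓘(ℂ) (F j) ∧
      (∃ a : ℂ, Tendsto (F j) UpperHalfPlane.atImInfty (𝓝 a)) ∧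
      ∀ (A : SL(2, ℤ)) (z : ℍ), (F j ∣[m - 2 * (j : ℤ)] A) z =
        ∑ i ∈ Finset.range (n - j + 1), ((n - j).choose i : ℂ) *
          ((A 1 0 : ℂ) / UpperHalfPlane.denom A z) ^ i * F (i + j) z := by
  have key (k : ℕ) (f : ℕ → ℂ) (c d : ℂ) : ∑ i ∈ Finset.range (k + 1),
      (k.choose i : ℂ) * (c / d) ^ i * f i =
      f 0 + ∑ i ∈ Finset.Icc 1 k, (k.choose i : ℂ) * c ^ i * (d ^ i)⁻¹ * f i := by
    rw [Finset.range_eq_Ico, Finset.sum_eq_sum_Ico_succ_bot (by omega)]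
    congr 1
    · simp
    · refine Finset.sum_congr (by ext; simp) fun i _ => ?_
      rw [div_pow]
      ring
  constructor
  · intro h j hj
    have h' : HasAssociated (n - j) (m - 2 * (j : ℤ)) (fun i => F (j + i)) := by
      rcases Nat.eq_zero_or_pos j with rfl | hj0
      · simpa using h
      · cases h with
        | intro _ _ _ h1 h2 h3 h4 => exact h3 j hj0 hj
    cases h' with
    | intro _ _ _ h1 h2 h3 h4 =>
      refine ⟨h1, h4, fun A z => ?_⟩
      have := h2 A z
      rw [key _ (fun i => F (i + j) z), ModularGroup.denom_apply]
      simp only [add_comm _ j]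
      rw [← this]
      simp
  · induction n using Nat.strong_induction_on generalizing m F with
    | _ n ih =>
      intro h
      obtain ⟨h1, h2, h3⟩ := h 0 (Nat.zero_le n)
      refine .intro n m F h1 (fun A z => ?_) (fun i hi hn => ?_) h2
      · have := h3 A z
        rw [key _ (fun i => F (i + 0) z), ModularGroup.denom_apply] at this
        simp only [Nat.cast_zero, mul_zero, sub_zero, add_zero] at this
        rw [this]
        simp
      · refine ih (n - i) (by omega) fun j hj => ?_
        obtain ⟨k1, k2, k3⟩ := h (i + j) (by omega)
        refine ⟨k1, k2, fun A z => ?_⟩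
        have := k3 A z
        rw [show m - 2 * (i : ℤ) - 2 * (j : ℤ) = m - 2 * ((i + j : ℕ) : ℤ) by push_cast; ring,
          this, Nat.sub_sub]
        refine Finset.sum_congr rfl fun k _ => ?_
        rw [show k + (i + j) = i + (k + j) by omega]

/-- A family of polynomials `P z = ∑ j, G j z X ^ j`, with holomorphic coefficients that have limits
at `i∞`, such that slashing the coefficients by `A` (that of `X ^ j` in weight `m - 2j`) amounts to
the translation `X ↦ X + c / (cz + d)`. An `M^n_m`-function with associated functions `F 1, …, F n`
corresponds to `G j = (n choose j) F j`; this normalisation removes the order `n` from the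
transformation law, so that `n` enters only as a bound for the degree. -/
structure IsAssociatedPolynomial (m : ℤ) (P : ℍ → ℂ[X]) : Prop where
  holo (j : ℕ) : MDifferentiable 𝓘(ℂ) 𝓘(ℂ) (fun z => (P z).coeff j)
  growth (j : ℕ) : ∃ a : ℂ, Tendsto (fun z => (P z).coeff j) UpperHalfPlane.atImInfty (𝓝 a)
  transf (j : ℕ) (A : SL(2, ℤ)) (z : ℍ) :
    ((fun w => (P w).coeff j) ∣[m - 2 * (j : ℤ)] A) z =
      (taylor ((A 1 0 : ℂ) / UpperHalfPlane.denom A z) (P z)).coeff j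

theorem choose_mul_choose_cast (n i j : ℕ) :
    (n.choose (i + j) : ℂ) * ((i + j).choose j : ℂ) =
      (n.choose j : ℂ) * ((n - j).choose i : ℂ) := by
  have := Nat.choose_mul (n := n) (Nat.le_add_left j i)
  rw [Nat.add_sub_cancel] at this
  exact_mod_cast this

/-- The space `M^n_m` consists of the constant coefficients of the families of polynomials of degree
at most `n` that transform by translation in weight `m`. -/
theorem mem_M_iff {n : ℕ} {m : ℤ} {f : ℍ → ℂ} :
    f ∈ M n m ↔ ∃ P : ℍ → ℂ[X], IsAssociatedPolynomial m P ∧ (∀ z, (P z).natDegree ≤ n) ∧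
      ∀ z, (P z).coeff 0 = f z := by
  constructor
  · rintro ⟨F, rfl, hF⟩
    rw [hasAssociated_iff] at hF
    set P : ℍ → ℂ[X] := fun z => ∑ i ∈ Finset.range (n + 1), C ((n.choose i : ℂ) * F i z) * X ^ i
    have hc (j : ℕ) (z : ℍ) : (P z).coeff j = (n.choose j : ℂ) * F j z := by
      simp only [P, finsetSum_coeff, coeff_C_mul_X_pow]
      rw [Finset.sum_ite_eq]
      split_ifs with h
      · rfl
      · rw [Nat.choose_eq_zero_of_lt (by simpa using h)]
        simp
    have hdeg (z : ℍ) : (P z).natDegree ≤ n := by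
      refine natDegree_le_iff_coeff_eq_zero.2 fun j hj => ?_
      rw [hc, Nat.choose_eq_zero_of_lt hj]
      simp
    refine ⟨P, ?_, hdeg, fun z => by simp [hc]⟩
    have hzero (j : ℕ) (hj : n < j) : (fun z => (P z).coeff j) = 0 := by
      funext z
      rw [hc, Nat.choose_eq_zero_of_lt hj]
      simp
    have heq (j : ℕ) : (fun z => (P z).coeff j) = (n.choose j : ℂ) • F j := by
      funext z
      simp [hc]
    refine ⟨fun j => ?_, fun j => ?_, fun j A z => ?_⟩
    · rcases lt_or_ge n j with hj | hj
      · rw [hzero j hj]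
        exact mdifferentiable_const
      · rw [heq]
        exact (hF j hj).1.const_smul _
    · rcases lt_or_ge n j with hj | hj
      · rw [hzero j hj]
        exact ⟨0, tendsto_const_nhds⟩
      · rw [heq]
        obtain ⟨a, ha⟩ := (hF j hj).2.1
        exact ⟨(n.choose j : ℂ) • a, ha.const_smul _⟩
    · rcases lt_or_ge n j with hj | hj
      · rw [hzero j hj, SlashAction.zero_slash, coeff_eq_zero_of_natDegree_lt]
        · rfl
        · rw [natDegree_taylor]
          exact (hdeg z).trans_lt hj
      · rw [heq, ModularForm.SL_smul_slash, Pi.smul_apply, (hF j hj).2.2 A z,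
          taylor_coeff_eq_sum _ (hdeg z), smul_eq_mul, Finset.mul_sum]
        refine Finset.sum_congr rfl fun i hi => ?_
        rw [hc]
        have h' := choose_mul_choose_cast n i j
        linear_combination (-(F (i + j) z) * ((A 1 0 : ℂ) / UpperHalfPlane.denom A z) ^ i) * h'
  · rintro ⟨P, hP, hdeg, h0⟩
    refine ⟨fun j z => (n.choose j : ℂ)⁻¹ * (P z).coeff j, ?_, hasAssociated_iff.2 fun j hj => ?_⟩
    · funext z
      simp [h0]
    have heq (j : ℕ) : (fun z => (n.choose j : ℂ)⁻¹ * (P z).coeff j) =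
        (n.choose j : ℂ)⁻¹ • fun z => (P z).coeff j := rfl
    rw [heq]
    refine ⟨(hP.holo j).const_smul _, ?_, fun A z => ?_⟩
    · obtain ⟨a, ha⟩ := hP.growth j
      exact ⟨(n.choose j : ℂ)⁻¹ • a, ha.const_smul _⟩
    · rw [ModularForm.SL_smul_slash, Pi.smul_apply, hP.transf, taylor_coeff_eq_sum _ (hdeg z),
        smul_eq_mul, Finset.mul_sum]
      refine Finset.sum_congr rfl fun i hi => ?_
      have hle : i + j ≤ n := by
        have := Finset.mem_range.1 hi
        omega
      have h' := choose_mul_choose_cast n i j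
      have e1 : (n.choose j : ℂ) ≠ 0 := by exact_mod_cast (Nat.choose_pos hj).ne'
      have e2 : (n.choose (i + j) : ℂ) ≠ 0 := by exact_mod_cast (Nat.choose_pos hle).ne'
      have h'' : (n.choose j : ℂ)⁻¹ * ((i + j).choose j : ℂ) =
        ((n - j).choose i : ℂ) * (n.choose (i + j) : ℂ)⁻¹ := by
        field_simp
        linear_combination h'
      linear_combination ((P z).coeff (i + j) *
        ((A 1 0 : ℂ) / UpperHalfPlane.denom A z) ^ i) * h''

/-- Translation `X ↦ X + r` is a ring homomorphism and slashing is multiplicative. -/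
theorem IsAssociatedPolynomial.mul {m m' : ℤ} {P Q : ℍ → ℂ[X]} (hP : IsAssociatedPolynomial m P)
    (hQ : IsAssociatedPolynomial m' Q) :
    IsAssociatedPolynomial (m + m') (fun z => P z * Q z) := by
  have heq (j : ℕ) : (fun z => (P z * Q z).coeff j) = ∑ x ∈ Finset.HasAntidiagonal.antidiagonal j,
      (fun z => (P z).coeff x.1) * (fun z => (Q z).coeff x.2) := by
    funext z
    simp [coeff_mul]
  refine ⟨fun j => ?_, fun j => ?_, fun j A z => ?_⟩
  · rw [heq]
    exact MDifferentiable.sum fun x _ => (hP.holo x.1).mul (hQ.holo x.2)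
  · choose a ha using hP.growth
    choose b hb using hQ.growth
    refine ⟨∑ x ∈ Finset.HasAntidiagonal.antidiagonal j, a x.1 * b x.2, ?_⟩
    rw [heq]
    have := tendsto_finsetSum (Finset.HasAntidiagonal.antidiagonal j) fun x _ =>
      (ha x.1).mul (hb x.2)
    exact this.congr fun z => by simp
  · rw [heq, SlashAction.sum_slash, taylor_mul, coeff_mul, Finset.sum_apply]
    refine Finset.sum_congr rfl fun x hx => ?_
    rw [← hP.transf, ← hQ.transf, ← Pi.mul_apply, ← ModularForm.mul_slash_SL2,
      ← Finset.HasAntidiagonal.mem_antidiagonal.1 hx,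
      show m + m' - 2 * ((x.1 + x.2 : ℕ) : ℤ) = m - 2 * (x.1 : ℤ) + (m' - 2 * (x.2 : ℤ)) by
        push_cast
        ring]

theorem mul_mem_M {n n' : ℕ} {m m' : ℤ} {f g : ℍ → ℂ} (hf : f ∈ M n m) (hg : g ∈ M n' m') :
    f * g ∈ M (n + n') (m + m') := by
  obtain ⟨P, hP, hPd, hP0⟩ := mem_M_iff.1 hf
  obtain ⟨Q, hQ, hQd, hQ0⟩ := mem_M_iff.1 hg
  exact mem_M_iff.2 ⟨_, hP.mul hQ, fun z => natDegree_mul_le.trans (add_le_add (hPd z) (hQd z)),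
    fun z => by simp [mul_coeff_zero, hP0, hQ0]⟩

theorem M_mono {n n' : ℕ} (h : n ≤ n') (m : ℤ) : M n m ≤ M n' m := by
  intro f hf
  obtain ⟨P, hP, hPd, hP0⟩ := mem_M_iff.1 hf
  exact mem_M_iff.2 ⟨P, hP, fun z => (hPd z).trans h, hP0⟩

theorem IsAssociatedPolynomial.sub {m : ℤ} {P Q : ℍ → ℂ[X]} (hP : IsAssociatedPolynomial m P)
    (hQ : IsAssociatedPolynomial m Q) : IsAssociatedPolynomial m (fun z => P z - Q z) := by
  have heq (j : ℕ) : (fun z => (P z - Q z).coeff j) =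
      (fun z => (P z).coeff j) + -(fun z => (Q z).coeff j) := by
    funext z
    simp [sub_eq_add_neg]
  refine ⟨fun j => ?_, fun j => ?_, fun j A z => ?_⟩
  · rw [heq]
    exact (hP.holo j).add (hQ.holo j).neg
  · obtain ⟨a, ha⟩ := hP.growth j
    obtain ⟨b, hb⟩ := hQ.growth j
    rw [heq]
    exact ⟨_, ha.add hb.neg⟩
  · rw [heq, SlashAction.add_slash, SlashAction.neg_slash, Pi.add_apply, Pi.neg_apply,
      hP.transf, hQ.transf, map_sub, coeff_sub, sub_eq_add_neg]

theorem IsAssociatedPolynomial.one : IsAssociatedPolynomial 0 (fun _ => 1) := by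
  refine ⟨fun j => mdifferentiable_const, fun j => ⟨_, tendsto_const_nhds⟩, fun j A z => ?_⟩
  rcases Nat.eq_zero_or_pos j with rfl | hj
  · have := congrFun (ModularForm.is_invariant_const A 1) z
    rw [taylor_one, coeff_C_zero]
    simpa [Function.const_def] using! this
  · have : (fun _ : ℍ => (1 : ℂ[X]).coeff j) = 0 := by
      funext z
      simp [coeff_one, hj.ne']
    rw [this, SlashAction.zero_slash]
    simp [coeff_one, hj.ne']

theorem IsAssociatedPolynomial.pow {m : ℤ} {P : ℍ → ℂ[X]} (hP : IsAssociatedPolynomial m P)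
    (k : ℕ) : IsAssociatedPolynomial (k * m) (fun z => P z ^ k) := by
  induction k with
  | zero => simpa using IsAssociatedPolynomial.one
  | succ k ih =>
    simp only [pow_succ]
    convert ih.mul hP using 1
    push_cast
    ring

theorem one_mem_M : (1 : ℍ → ℂ) ∈ M 0 0 :=
  mem_M_iff.2 ⟨_, .one, fun _ => by simp, fun _ => by simp⟩

theorem pow_mem_M {n : ℕ} {m : ℤ} {f : ℍ → ℂ} (hf : f ∈ M n m) (k : ℕ) :
    f ^ k ∈ M (k * n) (k * m) := by
  induction k with
  | zero => simpa using one_mem_M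
  | succ k ih =>
    rw [pow_succ]
    rw [show ((k + 1 : ℕ) : ℤ) * m = k * m + m by push_cast; ring,
      show (k + 1) * n = k * n + n by ring]
    exact mul_mem_M ih hf

/-! ### Modular forms of level one -/

/-- A holomorphic function of period `1` that is bounded at `i∞` has a limit there, because its cusp
function is analytic at `0`. -/
theorem tendsto_atImInfty {f : ℍ → ℂ}
    (hper : Function.Periodic (f ∘ UpperHalfPlane.ofComplex) (1 : ℝ))
    (hf : MDifferentiable 𝓘(ℂ) 𝓘(ℂ) f) (hbdd : UpperHalfPlane.IsBoundedAtImInfty f) :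
    Tendsto f UpperHalfPlane.atImInfty (𝓝 ((UpperHalfPlane.qExpansion 1 f).coeff 0)) := by
  have h := (UpperHalfPlane.analyticAt_cuspFunction_zero one_pos hper hf
    hbdd).continuousAt.tendsto.comp (UpperHalfPlane.qParam_tendsto_atImInfty one_pos)
  simpa [UpperHalfPlane.qExpansion_coeff] using
    h.congr fun z => UpperHalfPlane.eq_cuspFunction z one_ne_zero hper

theorem tendsto_modularForm {k : ℤ} (f : ModularForm 𝒮ℒ k) :
    Tendsto f UpperHalfPlane.atImInfty (𝓝 ((UpperHalfPlane.qExpansion 1 f).coeff 0)) :=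
  tendsto_atImInfty (SlashInvariantFormClass.periodic_comp_ofComplex f one_mem_strictPeriods_SL)
    (ModularFormClass.holo f) (ModularFormClass.bdd_at_infty f)

theorem slash_modularForm {k : ℤ} (f : ModularForm 𝒮ℒ k) (A : SL(2, ℤ)) : (f : ℍ → ℂ) ∣[k] A = f :=
  f.slash_action_eq' _ ⟨A, rfl⟩

/-- The space `M^0_m` is that of the classical modular forms of weight `m`. -/
theorem mem_M_zero_iff {m : ℤ} {f : ℍ → ℂ} :
    f ∈ M 0 m ↔ ∃ F : ModularForm 𝒮ℒ m, (F : ℍ → ℂ) = f := by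
  constructor
  · rintro ⟨F, rfl, hF⟩
    obtain ⟨h1, ⟨a, h2⟩, h3⟩ := hasAssociated_iff.1 hF 0 le_rfl
    have h3' (A : SL(2, ℤ)) : F 0 ∣[m] A = F 0 := by
      funext z
      simpa using h3 A z
    refine ⟨{ toFun := F 0, slash_action_eq' := ?_, holo' := h1, bdd_at_cusps' := ?_ }, rfl⟩
    · rintro _ ⟨A, rfl⟩
      exact h3' A
    · intro c hc
      rw [Subgroup.IsArithmetic.isCusp_iff_isCusp_SL2Z] at hc
      rw [OnePoint.isBoundedAt_iff_forall_SL2Z hc]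
      intro A _
      rw [h3']
      exact h2.isBigO_one ℝ
  · rintro ⟨F, rfl⟩
    refine ⟨fun _ => F, rfl, hasAssociated_iff.2 fun j hj => ?_⟩
    obtain rfl : j = 0 := by omega
    refine ⟨F.holo', ⟨_, tendsto_modularForm F⟩, fun A z => ?_⟩
    simpa using congrFun (slash_modularForm F A) z

theorem qExpansion_coeff_zero_monomial (b c : ℕ) :
    (UpperHalfPlane.qExpansion 1 ((ModularForm.E₄.pow b).mul (ModularForm.E₆.pow c))).coeff 0 =
      1 := by
  rw [ModularForm.qExpansion_mul one_pos one_mem_strictPeriods_SL,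
    ModularForm.qExpansion_pow one_pos one_mem_strictPeriods_SL,
    ModularForm.qExpansion_pow one_pos one_mem_strictPeriods_SL]
  have h4 := E_qExpansion_coeff_zero (k := 4) (by norm_num) ⟨2, rfl⟩
  have h6 := E_qExpansion_coeff_zero (k := 6) (by norm_num) ⟨3, rfl⟩
  rw [PowerSeries.coeff_zero_eq_constantCoeff_apply] at h4 h6 ⊢
  simp [h4, h6]

/-- Every modular form of level one is a linear combination of the monomials `E₄ ^ b * E₆ ^ c` of
the same weight: subtracting a multiple of one such monomial leaves a cusp form, and that is the
discriminant times a form of weight smaller by `12`. -/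
theorem modularForm_mem_span {k : ℤ} (f : ModularForm 𝒮ℒ k) :
    (f : ℍ → ℂ) ∈ Submodule.span ℂ {g : ℍ → ℂ | ∃ b c : ℕ, 4 * (b : ℤ) + 6 * (c : ℤ) = k ∧
      g = (ModularForm.E₄ : ℍ → ℂ) ^ b * (ModularForm.E₆ : ℍ → ℂ) ^ c} := by
  induction hN : k.toNat using Nat.strong_induction_on generalizing k with
  | _ N ih =>
    rcases lt_or_ge k 0 with hk | hk
    · rw [ModularFormClass.levelOne_neg_weight_eq_zero hk f]
      exact zero_mem _
    rcases Int.even_or_odd k with hev | hodd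
    swap
    · rw [ModularForm.levelOne_odd_weight_eq_zero hodd f]
      exact zero_mem _
    rcases eq_or_ne k 0 with rfl | hk0
    · obtain ⟨c, hc⟩ := ModularFormClass.levelOne_weight_zero_const f
      have : (f : ℍ → ℂ) = c • ((ModularForm.E₄ : ℍ → ℂ) ^ 0 * (ModularForm.E₆ : ℍ → ℂ) ^ 0) := by
        rw [hc]
        funext z
        simp
      rw [this]
      exact Submodule.smul_mem _ _ (Submodule.subset_span ⟨0, 0, by simp, rfl⟩)
    rcases eq_or_ne k 2 with rfl | hk2
    · rw [rank_zero_iff_forall_zero.1 ModularForm.levelOne_weight_two_rank_zero f]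
      exact zero_mem _
    obtain ⟨b, c, hbc⟩ : ∃ b c : ℕ, 4 * (b : ℤ) + 6 * (c : ℤ) = k := by
      obtain ⟨l, hl⟩ := hev
      rcases Int.even_or_odd' l with ⟨j, hj | hj⟩
      · exact ⟨j.toNat, 0, by omega⟩
      · exact ⟨(j - 1).toNat, 1, by omega⟩
    obtain ⟨g, hg⟩ := ModularForm.sub_smul_isCuspForm f
      (((ModularForm.E₄.pow b).mul (ModularForm.E₆.pow c)).mcast (by linarith))
      (qExpansion_coeff_zero_monomial b c)
    set a := (UpperHalfPlane.qExpansion 1 f).coeff 0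
    have hfg : (f : ℍ → ℂ) = a • ((ModularForm.E₄ : ℍ → ℂ) ^ b * (ModularForm.E₆ : ℍ → ℂ) ^ c) +
        (1 / 1728 : ℂ) • ((ModularForm.E₄ : ℍ → ℂ) ^ 3 * (CuspForm.discriminantEquiv g : ℍ → ℂ)) -
        (1 / 1728 : ℂ) •
          ((ModularForm.E₆ : ℍ → ℂ) ^ 2 * (CuspForm.discriminantEquiv g : ℍ → ℂ)) := by
      funext z
      have h1 : g z = f z - a * (ModularForm.E₄ z ^ b * ModularForm.E₆ z ^ c) := by
        have := DFunLike.congr_fun hg z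
        simpa [ModularForm.mcast_apply] using! this
      have h2 := ModularForm.discriminant_mul_discriminantEquiv_apply g z
      rw [ModularForm.discriminant_eq_E₄_cube_sub_E₆_sq] at h2
      simp only [Pi.add_apply, Pi.sub_apply, Pi.smul_apply, Pi.mul_apply, Pi.pow_apply, smul_eq_mul]
      linear_combination -h1 - h2
    have hd : (CuspForm.discriminantEquiv g : ℍ → ℂ) ∈ Submodule.span ℂ
        {g : ℍ → ℂ | ∃ b c : ℕ, 4 * (b : ℤ) + 6 * (c : ℤ) = k - 12 ∧
          g = (ModularForm.E₄ : ℍ → ℂ) ^ b * (ModularForm.E₆ : ℍ → ℂ) ^ c} :=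
      ih (k - 12).toNat (by omega) _ rfl
    rw [hfg]
    have hmul {b₀ c₀ : ℕ} (h₀ : 4 * (b₀ : ℤ) + 6 * (c₀ : ℤ) = 12) :
        (ModularForm.E₄ : ℍ → ℂ) ^ b₀ * (ModularForm.E₆ : ℍ → ℂ) ^ c₀ *
          (CuspForm.discriminantEquiv g : ℍ → ℂ) ∈ Submodule.span ℂ
            {g : ℍ → ℂ | ∃ b c : ℕ, 4 * (b : ℤ) + 6 * (c : ℤ) = k ∧
              g = (ModularForm.E₄ : ℍ → ℂ) ^ b * (ModularForm.E₆ : ℍ → ℂ) ^ c} := by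
      refine Submodule.span_induction (fun x hx => ?_) (by simp) (fun x y _ _ hx hy => ?_)
        (fun r x _ hx => ?_) hd
      · obtain ⟨b', c', h, rfl⟩ := hx
        exact Submodule.subset_span ⟨b₀ + b', c₀ + c', by push_cast; linarith, by ring⟩
      · rw [mul_add]
        exact add_mem hx hy
      · rw [mul_smul_comm]
        exact Submodule.smul_mem _ _ hx
    refine sub_mem (add_mem ?_ ?_) ?_
    · exact Submodule.smul_mem _ _ (Submodule.subset_span ⟨b, c, hbc, rfl⟩)
    · simpa using Submodule.smul_mem _ (1 / 1728 : ℂ) (hmul (b₀ := 3) (c₀ := 0) (by norm_num))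
    · simpa using Submodule.smul_mem _ (1 / 1728 : ℂ) (hmul (b₀ := 0) (c₀ := 2) (by norm_num))

/-! ### The Eisenstein series of weight two and the generators -/

/-- The constant `κ = -2πi / (2ζ(2))` in the transformation law
`E2 ∣[2] A = E2 + κ c / (cz + d)`. -/
noncomputable def E2Slope : ℂ := -(1 / (2 * riemannZeta 2)) * (2 * Real.pi * Complex.I)

theorem riemannZeta_natCast_ne_zero {k : ℕ} (hk : 1 < k) : riemannZeta k ≠ 0 :=
  riemannZeta_ne_zero_of_one_lt_re (by simpa using hk)

theorem E2Slope_ne_zero : E2Slope ≠ 0 := by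
  have := riemannZeta_natCast_ne_zero one_lt_two
  have h : riemannZeta 2 ≠ 0 := by simpa using this
  simp [E2Slope, h]

theorem E2_slash (A : SL(2, ℤ)) (z : ℍ) :
    (E2 ∣[(2 : ℤ)] A) z = E2 z + E2Slope * ((A 1 0 : ℂ) / UpperHalfPlane.denom A z) := by
  rw [E2_slash_action]
  simp only [Pi.sub_apply, Pi.smul_apply, D2, smul_eq_mul, E2Slope]
  ring

/-- The series `E2` is bounded at `i∞` and has period `1`, hence a limit. For `im w ≤ 0`
the map `ofComplex` is constant, so periodicity is trivial there. -/
theorem exists_tendsto_E2 : ∃ a, Tendsto E2 UpperHalfPlane.atImInfty (𝓝 a) := by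
  refine ⟨_, tendsto_atImInfty (fun w => ?_) E2_mdifferentiable isBoundedAtImInfty_E2⟩
  rcases lt_or_ge 0 w.im with hw | hw
  · have hw' : 0 < (w + (1 : ℝ)).im := by simpa using hw
    have he : Complex.exp (2 * Real.pi * Complex.I * (w + (1 : ℝ))) =
        Complex.exp (2 * Real.pi * Complex.I * w) := by
      rw [mul_add, Complex.exp_add, Complex.ofReal_one, mul_one, Complex.exp_two_pi_mul_I, mul_one]
    rw [Function.comp_apply, Function.comp_apply, UpperHalfPlane.ofComplex_apply_of_im_pos hw,
      UpperHalfPlane.ofComplex_apply_of_im_pos hw', E2_eq_tsum_cexp, E2_eq_tsum_cexp]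
    simp only [he]
  · have hw' : (w + (1 : ℝ)).im ≤ 0 := by simpa using hw
    simp only [Function.comp_apply, UpperHalfPlane.ofComplex_apply_of_im_nonpos hw,
      UpperHalfPlane.ofComplex_apply_of_im_nonpos hw']

/-- The linear polynomial `E2 + κ X` transforms by translation in weight `2`. -/
theorem isAssociatedPolynomial_E2 :
    IsAssociatedPolynomial 2 (fun z => C (E2 z) + C E2Slope * X) := by
  have h0 : (fun z => (C (E2 z) + C E2Slope * X : ℂ[X]).coeff 0) = E2 := by
    funext z
    simp
  have h1 : (fun z : ℍ => (C (E2 z) + C E2Slope * X : ℂ[X]).coeff 1) = fun _ => E2Slope := by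
    funext z
    simp [coeff_C]
  have h2 (j : ℕ) : (fun z : ℍ => (C (E2 z) + C E2Slope * X : ℂ[X]).coeff (j + 2)) = 0 := by
    funext z
    simp
  have ht (r : ℂ) (z : ℍ) : taylor r (C (E2 z) + C E2Slope * X) =
      C (E2 z + E2Slope * r) + C E2Slope * X := by
    simp [taylor_mul]
    ring
  refine ⟨fun j => ?_, fun j => ?_, fun j A z => ?_⟩ <;> rcases j with _ | _ | j
  · rw [h0]
    exact E2_mdifferentiable
  · rw [h1]
    exact mdifferentiable_const
  · rw [h2]
    exact mdifferentiable_const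
  · rw [h0]
    exact exists_tendsto_E2
  · rw [h1]
    exact ⟨_, tendsto_const_nhds⟩
  · rw [h2]
    exact ⟨0, tendsto_const_nhds⟩
  · rw [h0, ht]
    simpa using E2_slash A z
  · rw [h1, ht]
    have := congrFun (ModularForm.is_invariant_const A E2Slope) z
    have h3 (a : ℂ) : (C a + C E2Slope * X : ℂ[X]).coeff (0 + 1) = E2Slope := by
      simp [coeff_C]
    rw [h3]
    simpa [Function.const_def] using! this
  · rw [h2, ht, SlashAction.zero_slash]
    simp

theorem E2_mem_M : E2 ∈ M 1 2 :=
  mem_M_iff.2 ⟨_, isAssociatedPolynomial_E2, fun z => by compute_degree, fun z => by simp⟩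

theorem eis_one (a : ℂ) : eis 1 a = a • E2 := by
  funext z
  have hb : (|_root_.bernoulli (2 * 1)| : ℚ) = 1 / 6 := by
    rw [show _root_.bernoulli (2 * 1) = 1 / 6 by decide +kernel]
    norm_num
  simp only [eis, hb, Pi.smul_apply, smul_eq_mul, E2_eq_tsum_cexp]
  simp only [← Complex.exp_nat_mul]
  congr 1
  rw [sub_eq_add_neg, ← neg_mul]
  congr 2
  · norm_num
  · refine tsum_congr fun n => ?_
    congr 2
    ring

/-- The series `eis k a` is a multiple of Mathlib's Eisenstein series of weight `2k`, if the
Bernoulli number of index `2k` has its usual sign `(-1) ^ (k + 1)`. -/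
theorem eis_eq_smul_E {k : ℕ} (hk : 3 ≤ 2 * k) (a : ℂ)
    (hsign : ((-1) ^ k * |_root_.bernoulli (2 * k)| : ℚ) = -_root_.bernoulli (2 * k)) :
    eis k a = a • (ModularForm.E hk : ℍ → ℂ) := by
  funext z
  simp only [eis, Pi.smul_apply, smul_eq_mul, q_expansion_bernoulli hk (even_two_mul k),
    zpow_natCast, ← Complex.exp_nat_mul]
  congr 1
  rw [sub_eq_add_neg, ← neg_mul]
  congr 2
  · have h : ((-1) ^ k * ((|_root_.bernoulli (2 * k)| : ℚ) : ℂ)) =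
        -(_root_.bernoulli (2 * k) : ℂ) := by
      exact_mod_cast congrArg (Rat.cast : ℚ → ℂ) hsign
    have h1 : ((-1 : ℂ) ^ k) * (-1) ^ k = 1 := by
      rw [← mul_pow]
      simp
    rw [← neg_eq_iff_eq_neg] at h
    rw [← h]
    have hinv : ((-1 : ℂ) ^ k)⁻¹ = (-1) ^ k := inv_eq_of_mul_eq_one_right h1
    rw [div_neg, neg_neg, mul_comm ((-1 : ℂ) ^ k) ((|_root_.bernoulli (2 * k)| : ℚ) : ℂ), ← div_div,
      div_eq_mul_inv _ ((-1 : ℂ) ^ k), hinv]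
    push_cast
    ring
  · refine tsum_congr fun n => ?_
    congr 2
    ring

theorem exists_g₁_eq : ∃ a : ℂ, a ≠ 0 ∧ g₁ = a • E2 := by
  refine ⟨_, ?_, eis_one _⟩
  have := riemannZeta_natCast_ne_zero one_lt_two
  have h : riemannZeta 2 ≠ 0 := by simpa using this
  simp [h]

theorem exists_g₂_eq : ∃ a : ℂ, a ≠ 0 ∧ g₂ = a • (ModularForm.E₄ : ℍ → ℂ) := by
  refine ⟨_, ?_, eis_eq_smul_E (k := 2) (by norm_num) _ ?_⟩
  · have := riemannZeta_natCast_ne_zero (k := 4) (by norm_num)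
    have h : riemannZeta 4 ≠ 0 := by simpa using this
    simp [h]
  · rw [show _root_.bernoulli (2 * 2) = -1 / 30 by decide +kernel]
    norm_num

theorem exists_g₃_eq : ∃ a : ℂ, a ≠ 0 ∧ g₃ = a • (ModularForm.E₆ : ℍ → ℂ) := by
  refine ⟨_, ?_, eis_eq_smul_E (k := 3) (by norm_num) _ ?_⟩
  · have := riemannZeta_natCast_ne_zero (k := 6) (by norm_num)
    have h : riemannZeta 6 ≠ 0 := by simpa using this
    simp [h]
  · rw [show _root_.bernoulli (2 * 3) = 1 / 42 by decide +kernel]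
    norm_num

/-! ### Algebraic independence -/

/-- A polynomial that vanishes at infinitely many points of a polynomial curve vanishes on the
curve. -/
theorem eval_eq_zero_of_infinite {σ : Type*} {p : MvPolynomial σ ℂ} (φ : σ → ℂ[X]) {S : Set ℂ}
    (hS : S.Infinite) (h : ∀ t ∈ S, MvPolynomial.eval (fun i => (φ i).eval t) p = 0) (t : ℂ) :
    MvPolynomial.eval (fun i => (φ i).eval t) p = 0 := by
  have key (t : ℂ) : (MvPolynomial.aeval φ p).eval t =
      MvPolynomial.eval (fun i => (φ i).eval t) p := by
    rw [← coe_evalRingHom, MvPolynomial.aeval_def, MvPolynomial.hom_eval₂, MvPolynomial.eval]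
    congr 1
    ext
    simp
  rw [← key, eq_zero_of_infinite_isRoot (MvPolynomial.aeval φ p) (hS.mono fun t ht => ?_),
    eval_zero]
  exact (key t).trans (h t ht)

theorem exists_SL_lowerRow (c k : ℤ) : ∃ A : SL(2, ℤ), A 1 0 = c ∧ A 1 1 = c * k + 1 :=
  ⟨⟨!![1, k; c, c * k + 1], by simp [Matrix.det_fin_two]; ring⟩, by simp, by simp⟩

/-- Three functions that transform like the Eisenstein series of weights `2`, `4`, `6`, the first
with a genuine defect `κ ≠ 0`, are algebraically independent if `f₁³ / f₂²` takes infinitely many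
values. A relation `p` between them vanishes at `(J² f₀ + κ c J, J⁴ f₁, J⁶ f₂)` for all `J = cz + d`
that occur in the transformation law, hence for arbitrary complex `c` and `J`. So `p` vanishes at
`(x, J⁴ f₁, J⁶ f₂)` for all `x` and all `J ≠ 0`, and the points `(J⁴ f₁, J⁶ f₂)` cover the curves
`t ↦ (t² r, t³ r)`, `t ≠ 0`, for infinitely many `r`. -/
theorem algebraicIndependent_of_transf {f : Fin 3 → ℍ → ℂ} {κ : ℂ} (hκ : κ ≠ 0)
    (h0 : ∀ (A : SL(2, ℤ)) (z : ℍ), f 0 (A • z) = UpperHalfPlane.denom A z ^ 2 * f 0 z +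
      κ * (A 1 0 : ℂ) * UpperHalfPlane.denom A z)
    (h1 : ∀ (A : SL(2, ℤ)) (z : ℍ), f 1 (A • z) = UpperHalfPlane.denom A z ^ 4 * f 1 z)
    (h2 : ∀ (A : SL(2, ℤ)) (z : ℍ), f 2 (A • z) = UpperHalfPlane.denom A z ^ 6 * f 2 z)
    (hinf : (Set.range fun z => f 1 z ^ 3 / f 2 z ^ 2).Infinite) :
    AlgebraicIndependent ℂ f := by
  rw [algebraicIndependent_iff]
  intro p hp
  have hz (z : ℍ) : MvPolynomial.eval (fun i => f i z) p = 0 := by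
    have h := congrFun hp z
    have hcomp := DFunLike.congr_fun
      (MvPolynomial.comp_aeval (R := ℂ) f (Pi.evalAlgHom ℂ (fun _ : ℍ => ℂ) z)) p
    simp only [AlgHom.comp_apply, Pi.evalAlgHom_apply] at hcomp
    rw [h] at hcomp
    simpa [MvPolynomial.aeval_eq_eval] using hcomp.symm
  have vanish_of_int (z : ℍ) (c : ℤ) (hc : c ≠ 0) (J : ℂ) : MvPolynomial.eval
      ![J ^ 2 * f 0 z + κ * (c : ℂ) * J, J ^ 4 * f 1 z, J ^ 6 * f 2 z] p = 0 := by
    -- The lower rows `(c, ck + 1)` give infinitely many values of `J` for the same `c`.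
    have hS : (Set.range fun k : ℤ => (c : ℂ) * z + ((c * k + 1 : ℤ) : ℂ)).Infinite := by
      refine Set.infinite_range_of_injective fun k l hkl => ?_
      have := add_left_cancel hkl
      have := add_right_cancel (Int.cast_injective this)
      exact mul_left_cancel₀ hc this
    have := eval_eq_zero_of_infinite (p := p) ![X ^ 2 * C (f 0 z) + C (κ * c) * X,
      X ^ 4 * C (f 1 z), X ^ 6 * C (f 2 z)] hS ?_ J
    · convert this using 3
      funext i
      fin_cases i <;> simp <;> ring
    · rintro _ ⟨k, rfl⟩
      obtain ⟨A, hA0, hA1⟩ := exists_SL_lowerRow c k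
      have hd : UpperHalfPlane.denom A z = (c : ℂ) * z + ((c * k + 1 : ℤ) : ℂ) := by
        rw [ModularGroup.denom_apply, hA0, hA1]
      convert hz (A • z) using 3
      funext i
      fin_cases i
      · refine Eq.trans ?_ (h0 A z).symm
        rw [hd, hA0]
        simp
        ring
      · refine Eq.trans ?_ (h1 A z).symm
        rw [hd]
        simp
        ring
      · refine Eq.trans ?_ (h2 A z).symm
        rw [hd]
        simp
        ring
  have vanish_of_first (z : ℍ) (J : ℂ) (hJ : J ≠ 0) (x : ℂ) : MvPolynomial.eval
      ![x, J ^ 4 * f 1 z, J ^ 6 * f 2 z] p = 0 := by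
    have hS : ((fun c : ℤ => (c : ℂ)) '' {0}ᶜ).Infinite :=
      (Set.finite_singleton 0).infinite_compl.image Int.cast_injective.injOn
    have := eval_eq_zero_of_infinite (p := p) ![C (J ^ 2 * f 0 z) + C (κ * J) * X,
      C (J ^ 4 * f 1 z), C (J ^ 6 * f 2 z)] hS ?_ ((x - J ^ 2 * f 0 z) / (κ * J))
    · convert this using 3
      funext i
      fin_cases i
      · simp
        field_simp
        ring
      · simp
      · simp
    · rintro _ ⟨c, hc, rfl⟩
      convert vanish_of_int z c hc J using 3
      funext i
      fin_cases i
      · simp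
        ring
      · simp
      · simp
  have vanish_on_curve (x t r : ℂ) (ht : t ≠ 0) :
      MvPolynomial.eval ![x, t ^ 2 * r, t ^ 3 * r] p = 0 := by
    have := eval_eq_zero_of_infinite (p := p) ![C x, C (t ^ 2) * X, C (t ^ 3) * X]
      (hinf.sdiff (Set.finite_singleton 0)) ?_ r
    · convert this using 3
      funext i
      fin_cases i <;> simp
    · rintro _ ⟨⟨z, rfl⟩, hr⟩
      -- With `J² = t f₁ / f₂` the point `(J⁴ f₁, J⁶ f₂)` equals `(t² r, t³ r)` for `r = f₁³ / f₂²`.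
      have hr' : f 1 z ^ 3 / f 2 z ^ 2 ≠ 0 := hr
      have e1 : f 1 z ≠ 0 := fun h => hr' (by simp [h])
      have e2 : f 2 z ≠ 0 := fun h => hr' (by simp [h])
      obtain ⟨J, hJ⟩ := IsAlgClosed.exists_pow_nat_eq (t * f 1 z / f 2 z) two_pos
      have hJ0 : J ≠ 0 := by
        rintro rfl
        have : t * f 1 z / f 2 z ≠ 0 := div_ne_zero (mul_ne_zero ht e1) e2
        exact this (by rw [← hJ]; simp)
      convert vanish_of_first z J hJ0 x using 3
      funext i
      fin_cases i
      · simp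
      · simp only [show J ^ 4 = (J ^ 2) ^ 2 by ring, hJ]
        simp
        field_simp
      · simp only [show J ^ 6 = (J ^ 2) ^ 3 by ring, hJ]
        simp
        field_simp
  -- Every `(y, s)` with `y, s ≠ 0` is `(t² r, t³ r)` for `t = s / y` and `r = y³ / s²`.
  refine MvPolynomial.funext_set (fun _ => {0}ᶜ)
    (fun _ => (Set.finite_singleton (0 : ℂ)).infinite_compl) fun v hv => ?_
  have e1 : v 1 ≠ 0 := hv 1 trivial
  have e2 : v 2 ≠ 0 := hv 2 trivial
  rw [map_zero, ← vanish_on_curve (v 0) (v 2 / v 1) (v 1 ^ 3 / v 2 ^ 2) (div_ne_zero e2 e1)]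
  congr 1
  congr 1
  funext i
  fin_cases i
  · simp
  · simp
    field_simp
  · simp
    field_simp

theorem infinite_range_of_tendsto_of_ne {α X : Type*} [TopologicalSpace X] [T1Space X]
    {l : Filter α} [l.NeBot] {r : α → X} {b : X} (h : Tendsto r l (𝓝 b)) (hne : ∀ z, r z ≠ b) :
    (Set.range r).Infinite := by
  intro hfin
  have hb : b ∉ Set.range r := fun ⟨z, hz⟩ => hne z hz
  obtain ⟨z, hz⟩ := (h.eventually (hfin.isClosed.isOpen_compl.mem_nhds hb)).exists
  exact hz ⟨z, rfl⟩

/-- The quotient `E₄³ / E₆²` tends to `1` at `i∞`. It never equals `1`, since the discriminant has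
no zero, so it takes infinitely many values. -/
theorem algebraicIndependent_g : AlgebraicIndependent ℂ ![g₁, g₂, g₃] := by
  obtain ⟨a₁, h1, e1⟩ := exists_g₁_eq
  obtain ⟨a₂, h2, e2⟩ := exists_g₂_eq
  obtain ⟨a₃, h3, e3⟩ := exists_g₃_eq
  refine algebraicIndependent_of_transf (κ := a₁ * E2Slope) (mul_ne_zero h1 E2Slope_ne_zero)
    (fun A z => ?_) (fun A z => ?_) (fun A z => ?_) ?_
  · have hd := UpperHalfPlane.denom_ne_zero A z
    have := E2_slash A z
    rw [ModularForm.SL_slash_apply, zpow_neg, ← div_eq_mul_inv,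
      div_eq_iff (zpow_ne_zero _ hd)] at this
    simp only [e1, Matrix.cons_val_zero, Pi.smul_apply, smul_eq_mul, this]
    field_simp
  · have := congrFun (slash_modularForm ModularForm.E₄ A) z
    rw [ModularForm.slash_action_eq'_iff, ← ModularGroup.denom_apply] at this
    simp only [e2, Matrix.cons_val_one, Matrix.cons_val_zero, Pi.smul_apply, smul_eq_mul, this]
    norm_cast
    ring
  · have := congrFun (slash_modularForm ModularForm.E₆ A) z
    rw [ModularForm.slash_action_eq'_iff, ← ModularGroup.denom_apply] at this
    simp only [e3, Matrix.cons_val, Pi.smul_apply, smul_eq_mul, this]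
    norm_cast
    ring
  · have t4 := tendsto_modularForm ModularForm.E₄
    have t6 := tendsto_modularForm ModularForm.E₆
    rw [E_qExpansion_coeff_zero _ ⟨2, rfl⟩] at t4
    rw [E_qExpansion_coeff_zero _ ⟨3, rfl⟩] at t6
    have ht := ((t4.pow 3).div (t6.pow 2) (by simp)).const_mul (a₂ ^ 3 / a₃ ^ 2)
    refine infinite_range_of_tendsto_of_ne (l := UpperHalfPlane.atImInfty)
      (b := a₂ ^ 3 / a₃ ^ 2) ?_ fun z hz => ?_
    · convert ht using 2
      · simp only [e2, e3, Matrix.cons_val, Matrix.cons_val_one, Pi.smul_apply, smul_eq_mul]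
        simp
        ring
      · simp
    · have hΔ := ModularForm.discriminant_ne_zero z
      rw [ModularForm.discriminant_eq_E₄_cube_sub_E₆_sq] at hΔ
      simp [e2, e3] at hz
      rcases eq_or_ne (ModularForm.E₆ z) 0 with h6 | h6
      -- At a zero of `E₆` the quotient is `0` by the convention for division by zero.
      · rw [h6] at hz
        have : a₂ ^ 3 / a₃ ^ 2 ≠ 0 := div_ne_zero (pow_ne_zero _ h2) (pow_ne_zero _ h3)
        simp at hz
        exact this hz.symm
      · apply hΔ
        field_simp at hz
        rw [hz]
        simp

/-! ### Spanning by monomials -/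

/-- Rescaling the three generators does not enlarge the span of a set of monomials. -/
theorem span_monomials_smul {f₁ f₂ f₃ h₁ h₂ h₃ : ℍ → ℂ} {a₁ a₂ a₃ : ℂ} (e₁ : f₁ = a₁ • h₁)
    (e₂ : f₂ = a₂ • h₂) (e₃ : f₃ = a₃ • h₃) (p : ℕ → ℕ → ℕ → Prop) :
    Submodule.span ℂ {f : ℍ → ℂ | ∃ a b c : ℕ, p a b c ∧ f = f₁ ^ a * f₂ ^ b * f₃ ^ c} ≤
      Submodule.span ℂ {f : ℍ → ℂ | ∃ a b c : ℕ, p a b c ∧ f = h₁ ^ a * h₂ ^ b * h₃ ^ c} := by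
  rw [Submodule.span_le]
  rintro _ ⟨a, b, c, h, rfl⟩
  have : f₁ ^ a * f₂ ^ b * f₃ ^ c =
      (a₁ ^ a * a₂ ^ b * a₃ ^ c) • (h₁ ^ a * h₂ ^ b * h₃ ^ c) := by
    rw [e₁, e₂, e₃, _root_.smul_pow, _root_.smul_pow, _root_.smul_pow,
      smul_mul_smul_comm, smul_mul_smul_comm]
  rw [this]
  exact Submodule.smul_mem _ _ (Submodule.subset_span ⟨a, b, c, h, rfl⟩)

/-- Induction on the order `n`: the leading coefficient `h` of the polynomial of `f` is a modular
form, and subtracting `κ⁻ⁿ h (E2 + κ X)ⁿ` from the polynomial lowers its degree. -/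
theorem mem_span_eisenstein {n : ℕ} {m : ℤ} {f : ℍ → ℂ} (hf : f ∈ M n m) :
    f ∈ Submodule.span ℂ {f : ℍ → ℂ | ∃ a b c : ℕ,
      (a ≤ n ∧ 2 * (a : ℤ) + 4 * (b : ℤ) + 6 * (c : ℤ) = m) ∧
      f = E2 ^ a * (ModularForm.E₄ : ℍ → ℂ) ^ b * (ModularForm.E₆ : ℍ → ℂ) ^ c} := by
  have lead (n : ℕ) {h : ℍ → ℂ} (hh : h ∈ M 0 (m - 2 * (n : ℤ))) :
      h * E2 ^ n ∈ Submodule.span ℂ {f : ℍ → ℂ | ∃ a b c : ℕ,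
        (a ≤ n ∧ 2 * (a : ℤ) + 4 * (b : ℤ) + 6 * (c : ℤ) = m) ∧
        f = E2 ^ a * (ModularForm.E₄ : ℍ → ℂ) ^ b * (ModularForm.E₆ : ℍ → ℂ) ^ c} := by
    obtain ⟨F, rfl⟩ := mem_M_zero_iff.1 hh
    refine Submodule.span_induction (fun x hx => ?_) (by simp) (fun x y _ _ hx hy => ?_)
      (fun r x _ hx => ?_) (modularForm_mem_span F)
    · obtain ⟨b, c, h, rfl⟩ := hx
      exact Submodule.subset_span ⟨n, b, c, ⟨le_rfl, by linarith⟩, by ring⟩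
    · rw [add_mul]
      exact add_mem hx hy
    · rw [smul_mul_assoc]
      exact Submodule.smul_mem _ _ hx
  induction n generalizing f with
  | zero => simpa using lead 0 (by simpa using hf)
  | succ n ih =>
    obtain ⟨P, hP, hPd, hP0⟩ := mem_M_iff.1 hf
    set h : ℍ → ℂ := fun z => (P z).coeff (n + 1) with h_def
    -- The coefficient of `X ^ (n + 1)` is unchanged by translation, hence slash-invariant.
    have hM : h ∈ M 0 (m - 2 * ((n + 1 : ℕ) : ℤ)) := by
      refine ⟨fun _ => h, rfl, hasAssociated_iff.2 fun j hj => ?_⟩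
      obtain rfl : j = 0 := by omega
      refine ⟨hP.holo _, hP.growth _, fun A z => ?_⟩
      have := hP.transf (n + 1) A z
      rw [taylor_coeff_eq_sum _ (hPd z)] at this
      simpa using this
    have hC : IsAssociatedPolynomial (m - 2 * ((n + 1 : ℕ) : ℤ))
        (fun z => C (E2Slope⁻¹ ^ (n + 1) * h z)) := by
      obtain ⟨Q, hQ, hQd, hQ0⟩ := mem_M_iff.1 (Submodule.smul_mem _ (E2Slope⁻¹ ^ (n + 1)) hM)
      convert hQ using 2 with z
      rw [eq_C_of_natDegree_le_zero (hQd z), hQ0]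
      simp
    have hsub : f - E2Slope⁻¹ ^ (n + 1) • (h * E2 ^ (n + 1)) ∈ M n m := by
      have hR := hC.mul (isAssociatedPolynomial_E2.pow (n + 1))
      rw [show m - 2 * ((n + 1 : ℕ) : ℤ) + ((n + 1 : ℕ) : ℤ) * 2 = m by ring] at hR
      have hL (z : ℍ) : (C (E2 z) + C E2Slope * X).natDegree ≤ 1 := by compute_degree
      have hRd (z : ℍ) : (C (E2Slope⁻¹ ^ (n + 1) * h z) *
          (C (E2 z) + C E2Slope * X) ^ (n + 1)).natDegree ≤ n + 1 :=
        (natDegree_C_mul_le _ _).trans (by simpa using natDegree_pow_le_of_le (n + 1) (hL z))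
      refine mem_M_iff.2 ⟨_, hP.sub hR, fun z => ?_, fun z => ?_⟩
      · refine natDegree_le_iff_coeff_eq_zero.2 fun j hj => ?_
        rcases (Nat.succ_le_of_lt hj).eq_or_lt with rfl | hj'
        · have hcoeff := coeff_pow_of_natDegree_le (m := n + 1) (hL z)
          rw [mul_one] at hcoeff
          rw [coeff_sub, coeff_C_mul, Nat.succ_eq_add_one, hcoeff]
          have h1 : (C (E2 z) + C E2Slope * X).coeff 1 = E2Slope := by simp [coeff_C]
          rw [h1, mul_right_comm, ← mul_pow, inv_mul_cancel₀ E2Slope_ne_zero]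
          simp [h_def]
        · rw [coeff_sub, coeff_eq_zero_of_natDegree_lt ((hPd z).trans_lt hj'),
            coeff_eq_zero_of_natDegree_lt ((hRd z).trans_lt hj'), sub_zero]
      · simp [coeff_zero_eq_eval_zero, ← hP0]
        ring
    rw [← sub_add_cancel f (E2Slope⁻¹ ^ (n + 1) • (h * E2 ^ (n + 1)))]
    refine add_mem (Submodule.span_mono ?_ (ih hsub)) (Submodule.smul_mem _ _ (lead _ hM))
    rintro _ ⟨a, b, c, ⟨ha, hw⟩, rfl⟩
    exact ⟨a, b, c, ⟨ha.trans n.le_succ, hw⟩, rfl⟩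

theorem g₁_mem_M : g₁ ∈ M 1 2 := by
  obtain ⟨a, -, h⟩ := exists_g₁_eq
  rw [h]
  exact Submodule.smul_mem _ _ E2_mem_M

theorem g₂_mem_M : g₂ ∈ M 0 4 := by
  obtain ⟨a, -, h⟩ := exists_g₂_eq
  rw [h]
  exact Submodule.smul_mem _ _ (mem_M_zero_iff.2 ⟨ModularForm.E₄, rfl⟩)

theorem g₃_mem_M : g₃ ∈ M 0 6 := by
  obtain ⟨a, -, h⟩ := exists_g₃_eq
  rw [h]
  exact Submodule.smul_mem _ _ (mem_M_zero_iff.2 ⟨ModularForm.E₆, rfl⟩)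

theorem M_eq_span (n : ℕ) (m : ℤ) : M n m =
    Submodule.span ℂ {f : ℍ → ℂ | ∃ a b c : ℕ, a ≤ n ∧
      2 * (a : ℤ) + 4 * (b : ℤ) + 6 * (c : ℤ) = m ∧ f = g₁ ^ a * g₂ ^ b * g₃ ^ c} := by
  apply le_antisymm
  · intro f hf
    obtain ⟨a₁, h1, e1⟩ := exists_g₁_eq
    obtain ⟨a₂, h2, e2⟩ := exists_g₂_eq
    obtain ⟨a₃, h3, e3⟩ := exists_g₃_eq
    have := span_monomials_smul ((inv_smul_eq_iff₀ h1).2 e1).symm ((inv_smul_eq_iff₀ h2).2 e2).symm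
      ((inv_smul_eq_iff₀ h3).2 e3).symm _ (mem_span_eisenstein hf)
    simpa only [and_assoc] using this
  · rw [Submodule.span_le]
    rintro _ ⟨a, b, c, ha, hw, rfl⟩
    have h := mul_mem_M (mul_mem_M (pow_mem_M g₁_mem_M a) (pow_mem_M g₂_mem_M b))
      (pow_mem_M g₃_mem_M c)
    rw [show (a : ℤ) * 2 + b * 4 + c * 6 = m by linarith] at h
    exact M_mono (by simpa using ha) m h

theorem iSup_M_eq_span (m : ℤ) : ⨆ n : ℕ, M n m =
    Submodule.span ℂ {f : ℍ → ℂ | ∃ a b c : ℕ,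
      2 * (a : ℤ) + 4 * (b : ℤ) + 6 * (c : ℤ) = m ∧ f = g₁ ^ a * g₂ ^ b * g₃ ^ c} := by
  simp only [M_eq_span, ← Submodule.span_iUnion]
  congr 1
  ext f
  simp only [Set.mem_iUnion, Set.mem_ofPred_eq]
  constructor
  · rintro ⟨n, a, b, c, -, h⟩
    exact ⟨a, b, c, h⟩
  · rintro ⟨a, b, c, h⟩
    exact ⟨a, a, b, c, le_rfl, h⟩

/-- The monomials in `g₁, g₂, g₃` are linearly independent, and the spaces of different weights are
spanned by disjoint sets of monomials. -/
theorem iSupIndep_iSup_M : iSupIndep (fun m : ℤ => ⨆ n : ℕ, M n m) := by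
  set v : (Fin 3 →₀ ℕ) → ℍ → ℂ := fun s => g₁ ^ s 0 * g₂ ^ s 1 * g₃ ^ s 2 with v_def
  have hv : LinearIndependent ℂ v := by
    have h := (MvPolynomial.basisMonomials (Fin 3) ℂ).linearIndependent.map'
      (MvPolynomial.aeval ![g₁, g₂, g₃]).toLinearMap (LinearMap.ker_eq_bot.2 algebraicIndependent_g)
    have hv_eq : v = (MvPolynomial.aeval ![g₁, g₂, g₃]).toLinearMap ∘
        MvPolynomial.basisMonomials (Fin 3) ℂ := by
      funext s
      simp [v_def, MvPolynomial.aeval_monomial, Finsupp.prod_fintype, Fin.prod_univ_three]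
    rw [hv_eq]
    exact h
  set wt : (Fin 3 →₀ ℕ) → ℤ := fun s => 2 * (s 0 : ℤ) + 4 * (s 1 : ℤ) + 6 * (s 2 : ℤ) with wt_def
  have hspan (m : ℤ) : ⨆ n : ℕ, M n m = Submodule.span ℂ (v '' {s | wt s = m}) := by
    rw [iSup_M_eq_span]
    congr 1
    ext f
    constructor
    · rintro ⟨a, b, c, h, rfl⟩
      exact ⟨Finsupp.equivFunOnFinite.symm ![a, b, c], by simpa [wt_def] using h, by simp [v_def]⟩
    · rintro ⟨s, h, rfl⟩
      exact ⟨s 0, s 1, s 2, h, rfl⟩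
  intro m
  simp only [hspan, ← Submodule.span_iUnion, ← Set.image_iUnion]
  refine hv.disjoint_span_image (Set.disjoint_left.2 fun s hs hs' => ?_)
  simp only [Set.mem_iUnion, Set.mem_ofPred_eq] at hs hs'
  obtain ⟨j, hj, rfl⟩ := hs'
  exact hj hs

theorem iSup_M_eq_adjoin : (⨆ (n : ℕ) (m : ℤ), M n m) =
    Subalgebra.toSubmodule (Algebra.adjoin ℂ {g₁, g₂, g₃}) := by
  apply le_antisymm
  · refine iSup₂_le fun n m => ?_
    rw [M_eq_span, Submodule.span_le]
    rintro _ ⟨a, b, c, -, -, rfl⟩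
    rw [SetLike.mem_coe, Subalgebra.mem_toSubmodule]
    exact mul_mem (mul_mem (pow_mem (Algebra.subset_adjoin (by simp)) a)
      (pow_mem (Algebra.subset_adjoin (by simp)) b)) (pow_mem (Algebra.subset_adjoin (by simp)) c)
  · rw [Algebra.adjoin_eq_span, Submodule.span_le]
    intro f hf
    suffices ∃ n m, f ∈ M n m by
      obtain ⟨n, m, h⟩ := this
      exact Submodule.mem_iSup_of_mem n (Submodule.mem_iSup_of_mem m h)
    induction hf using Submonoid.closure_induction with
    | mem x hx =>
      rcases hx with rfl | rfl | rfl
      · exact ⟨1, 2, g₁_mem_M⟩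
      · exact ⟨0, 4, g₂_mem_M⟩
      · exact ⟨0, 6, g₃_mem_M⟩
    | one => exact ⟨0, 0, one_mem_M⟩
    | mul x y _ _ hx hy =>
      obtain ⟨n, m, h⟩ := hx
      obtain ⟨n', m', h'⟩ := hy
      exact ⟨_, _, mul_mem_M h h'⟩

theorem finiteDimensional_M (n : ℕ) (m : ℤ) : FiniteDimensional ℂ (M n m) := by
  rw [M_eq_span]
  refine FiniteDimensional.span_of_finite ℂ (Set.Finite.subset
    (((Set.finite_Iic m.toNat).prod ((Set.finite_Iic m.toNat).prod (Set.finite_Iic m.toNat))).image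
      fun s : ℕ × ℕ × ℕ => g₁ ^ s.1 * g₂ ^ s.2.1 * g₃ ^ s.2.2) ?_)
  rintro _ ⟨a, b, c, -, h, rfl⟩
  exact ⟨(a, b, c), ⟨by simp; omega, by simp; omega, by simp; omega⟩, rfl⟩

end DiffModForm

theorem theorem1 :
    -- algebraic independence of the three Eisenstein series
    AlgebraicIndependent ℂ ![DiffModForm.g₁, DiffModForm.g₂, DiffModForm.g₃] ∧
    -- they lie in the indicated spaces
    DiffModForm.g₁ ∈ DiffModForm.M 1 2 ∧ DiffModForm.g₂ ∈ DiffModForm.M 0 4 ∧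
      DiffModForm.g₃ ∈ DiffModForm.M 0 6 ∧
    -- products respect both indices, and different weights are linearly independent
    (∀ (n n' : ℕ) (m m' : ℤ),
      DiffModForm.M n m * DiffModForm.M n' m' ≤ DiffModForm.M (n + n') (m + m')) ∧
    iSupIndep (fun m : ℤ => ⨆ n : ℕ, DiffModForm.M n m) ∧
    -- the sum of all the spaces is the algebra generated by the three series
    (⨆ (n : ℕ) (m : ℤ), DiffModForm.M n m) =
      Subalgebra.toSubmodule
        (Algebra.adjoin ℂ {DiffModForm.g₁, DiffModForm.g₂, DiffModForm.g₃}) ∧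
    -- the same, index by index
    (∀ (n : ℕ) (m : ℤ), DiffModForm.M n m =
      Submodule.span ℂ {f : UpperHalfPlane → ℂ | ∃ a b c : ℕ, a ≤ n ∧
        2 * (a : ℤ) + 4 * (b : ℤ) + 6 * (c : ℤ) = m ∧
        f = DiffModForm.g₁ ^ a * DiffModForm.g₂ ^ b * DiffModForm.g₃ ^ c}) ∧
    -- finite dimensionality
    (∀ (n : ℕ) (m : ℤ), FiniteDimensional ℂ (DiffModForm.M n m)) := by
  exact ⟨DiffModForm.algebraicIndependent_g, DiffModForm.g₁_mem_M, DiffModForm.g₂_mem_M,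
    DiffModForm.g₃_mem_M, fun _ _ _ _ => Submodule.mul_le.2 fun _ hf _ hg =>
      DiffModForm.mul_mem_M hf hg, DiffModForm.iSupIndep_iSup_M, DiffModForm.iSup_M_eq_adjoin,
    DiffModForm.M_eq_span, DiffModForm.finiteDimensional_M⟩
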